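/- For $a\in\mathbb{C}$ and $n\ge 0$ let $(a)_n=a(a+1)\cdots(a+n-1)$ (with $(a)_0=1$). For every complex number $s$, the following series converge absolutely whenever their terms are defined (that is, $s\ne\tfrac12$ for the first, no restriction for the second, $s\neq 0$ for the third), and \[ \sum_{n=0}^\infty \frac{(s)_n^2(1-s)_n^2}{(\frac12)_n\,n!^3}\,\frac{s(1-s)+2(1-s+s^2)n+3n^2-6n^3}{(1-2s)^2\,4^n}=\frac{\sin(\pi s)}{\pi}\qquad(s\ne\tfrac12), \] \[ \sum_{n=0}^\infty \frac{(s)_n^2(1-s)_n^2}{(\frac32)_n\,n!^3}\,\frac{s(1-s)+2n+3n^2}{4^n}=\frac{\sin(\pi s)}{\pi}, \] \[ \sum_{n=0}^\infty \frac{(s)_n^2(-s)_n^2}{(\frac12)_n\,n!^3}\,\frac{s^2-3n^2}{s\,4^n}=\frac{\sin(\pi s)}{\pi}\qquad(s\ne 0). \] In particular (the first series at $s=\tfrac14$), \[ \sum_{n=0}^\infty \binom{4n}{2n}^2\binom{2n}{n}\frac{3+26n+48n^2-96n^3}{2^{12n}}=\frac{2\sqrt2}{\pi}. \] -/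

import Mathlib

/-!
Write `r k = (s)_k (1-s)_k / k!²`, `w = s (1 - s)` and `weight s n = r n ² / binom(2n, n)`, which is
the factor `((s)_n (1-s)_n)² / ((2n)! n!²)` common to the series. Since `(3/2)_n n! 4ⁿ = (2n+1)!`,
the second series has the terms `weight s n * (w + 2 n + 3 n²) / (2 n + 1)`.

It is summed by the Wilf–Zeilberger pair
* `G(n, k) = r k * weight s n * (w + 2 n + 3 n² + k (2 n + 1)) / ((2 n + 1) binom(n+k, k)²)`,
* `F(n, k) = r k * weight s n * 2 n / binom(n+k, k)²`,

which satisfies `G(n, k+1) - G(n, k) = F(n+1, k) - F(n, k)` (`wzG_succ`). As `F(0, k) = 0` and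
`F(n, k) → 0` as `n → ∞`, the sum `∑ₙ G(n, k)` does not depend on `k`. At `k = 0` it is the series;
as `k → ∞`, by dominated convergence, it tends to the limit of its term `n = 0`, which is
`lim r k (k + w) = sin (π s) / π` by Euler's product (`tendsto_pochRatio_mul_add`, `hasSum_wzG_zero`).

The first and the third series differ from the second one by the increments of a null sequence that
starts at `0`, namely `8 n³ weight s n / (1 - 2 s)²` (`hasSum_half_one_sub`) and
`2 n³ ((s)_n (-s)_n)² / (s² (2n)! n!²)` (`hasSum_half_neg`). The series of binomial coefficients is
four times the first series at `s = 1/4`.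
-/

open Filter Topology

/-! ### Ratios of rising factorials -/

/-- The ratio `(a)_n (b)_n / n!²` of rising factorials. -/
noncomputable def pochRatio (a b : ℂ) (n : ℕ) : ℂ :=
  (ascPochhammer ℂ n).eval a * (ascPochhammer ℂ n).eval b / (n.factorial : ℂ) ^ 2

lemma pochRatio_zero (a b : ℂ) : pochRatio a b 0 = 1 := by
  simp [pochRatio]

lemma pochRatio_succ (a b : ℂ) (n : ℕ) :
    pochRatio a b (n + 1) = pochRatio a b n * ((a + n) * (b + n)) / ((n : ℂ) + 1) ^ 2 := by
  have h1 : (n : ℂ) + 1 ≠ 0 := Nat.cast_add_one_ne_zero n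
  have h2 : (n.factorial : ℂ) ≠ 0 := Nat.cast_ne_zero.mpr n.factorial_ne_zero
  simp only [pochRatio, ascPochhammer_succ_eval, Nat.factorial_succ, Nat.cast_mul, Nat.cast_add,
    Nat.cast_one]
  field_simp

lemma ascPochhammer_neg_mul (s : ℂ) (n : ℕ) :
    (ascPochhammer ℂ n).eval (-s) * (n - s) = -s * (ascPochhammer ℂ n).eval (1 - s) := by
  induction n with
  | zero => simp
  | succ n ih =>
    rw [ascPochhammer_succ_eval, ascPochhammer_succ_eval, ← mul_assoc, ← ih]
    push_cast
    ring

lemma ascPochhammer_half_eval (n : ℕ) :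
    (ascPochhammer ℂ n).eval (1 / 2 : ℂ) * 4 ^ n = n.factorial * n.centralBinom := by
  induction n with
  | zero => simp
  | succ n ih =>
    have h := congrArg (Nat.cast : ℕ → ℂ) (Nat.succ_mul_centralBinom_succ n)
    push_cast at h
    rw [ascPochhammer_succ_eval, Nat.factorial_succ]
    push_cast
    linear_combination (4 * (1 / 2 + (n : ℂ))) * ih - (n.factorial : ℂ) * h

lemma ascPochhammer_three_halves_eval (n : ℕ) :
    (ascPochhammer ℂ n).eval (3 / 2 : ℂ) = (ascPochhammer ℂ n).eval (1 / 2 : ℂ) * (2 * n + 1) := by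
  induction n with
  | zero => simp
  | succ n ih =>
    rw [ascPochhammer_succ_eval, ascPochhammer_succ_eval, ih]
    push_cast
    ring

/-! ### Asymptotics and bounds -/

/-- Euler's product for the sine, written with rising factorials. -/
lemma tendsto_pochRatio_mul_add_self (s : ℂ) :
    Tendsto (fun k : ℕ => pochRatio s (1 - s) k * (k + s)) atTop
      (𝓝 (Complex.sin (Real.pi * s) / Real.pi)) := by
  have hpi : (Real.pi : ℂ) ≠ 0 := Complex.ofReal_ne_zero.mpr Real.pi_ne_zero
  refine ((Complex.tendsto_euler_sin_prod s).div_const (Real.pi : ℂ)).congr fun k => ?_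
  rw [mul_assoc, mul_div_cancel_left₀ _ hpi]
  induction k with
  | zero => simp [pochRatio_zero]
  | succ k ih =>
    have h1 : (k : ℂ) + 1 ≠ 0 := Nat.cast_add_one_ne_zero k
    rw [Finset.prod_range_succ, ← mul_assoc, ih, pochRatio_succ]
    push_cast
    field_simp
    ring

/-- The limit does not depend on `a`, because `(k + a) / (k + s) → 1`. -/
lemma tendsto_pochRatio_mul_add (s a : ℂ) :
    Tendsto (fun k : ℕ => pochRatio s (1 - s) k * (k + a)) atTop
      (𝓝 (Complex.sin (Real.pi * s) / Real.pi)) := by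
  have hinf : Tendsto (fun k : ℕ => (k : ℂ) + s) atTop (Bornology.cobounded ℂ) :=
    tendsto_add_const_cobounded s |>.comp tendsto_natCast_atTop_cobounded
  have hne : ∀ᶠ k : ℕ in atTop, (k : ℂ) + s ≠ 0 := hinf.eventually_ne_cobounded 0
  have hinv : Tendsto (fun k : ℕ => ((k : ℂ) + s)⁻¹) atTop (𝓝 0) :=
    tendsto_inv₀_cobounded.comp hinf
  have h := (tendsto_pochRatio_mul_add_self s).mul ((hinv.mul_const (a - s)).const_add 1)
  rw [zero_mul, add_zero, mul_one] at h
  refine h.congr' ?_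
  filter_upwards [hne] with k hk
  field_simp
  ring

lemma exists_norm_pochRatio_mul_le (s : ℂ) :
    ∃ M : ℝ, ∀ k : ℕ, ‖pochRatio s (1 - s) k‖ * (k + 1) ≤ M := by
  obtain ⟨M, hM⟩ := (tendsto_pochRatio_mul_add s 1).norm.bddAbove_range
  refine ⟨M, fun k => ?_⟩
  have h : ‖pochRatio s (1 - s) k * (k + 1)‖ ≤ M := hM ⟨k, rfl⟩
  have h1 : ‖(k : ℂ) + 1‖ = (k : ℝ) + 1 := by
    rw [← Nat.cast_add_one, Complex.norm_natCast, Nat.cast_add_one]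
  rwa [norm_mul, h1] at h

lemma exists_norm_pochRatio_le (s : ℂ) : ∃ M : ℝ, ∀ k : ℕ, ‖pochRatio s (1 - s) k‖ ≤ M := by
  obtain ⟨M, hM⟩ := exists_norm_pochRatio_mul_le s
  exact ⟨M, fun k => le_trans
    (le_mul_of_one_le_right (norm_nonneg _) (le_add_of_nonneg_left k.cast_nonneg)) (hM k)⟩

lemma exists_norm_pochRatio_neg_le (s : ℂ) : ∃ M : ℝ, ∀ k : ℕ, ‖pochRatio s (-s) k‖ ≤ M := by
  -- The shifted sequence is Euler's convergent sequence times `-s / (k + 1)²`, so it tends to `0`.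
  have hsucc : ∀ k : ℕ, pochRatio s (-s) (k + 1)
      = pochRatio s (1 - s) k * (k + s) * -s * (((k : ℂ) + 1)⁻¹ * ((k : ℂ) + 1)⁻¹) := by
    intro k
    have h1 : (k : ℂ) + 1 ≠ 0 := Nat.cast_add_one_ne_zero k
    have h2 : (k.factorial : ℂ) ≠ 0 := Nat.cast_ne_zero.mpr k.factorial_ne_zero
    rw [pochRatio_succ]
    simp only [pochRatio]
    field_simp
    linear_combination (ascPochhammer ℂ k).eval s * (s + k) * ascPochhammer_neg_mul s k
  have hinv : Tendsto (fun k : ℕ => ((k : ℂ) + 1)⁻¹) atTop (𝓝 0) := by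
    simpa using tendsto_one_div_add_atTop_nhds_zero_nat (𝕜 := ℂ)
  have h := ((tendsto_pochRatio_mul_add_self s).mul_const (-s)).mul (hinv.mul hinv)
  obtain ⟨M, hM⟩ :=
    ((tendsto_add_atTop_iff_nat 1).mp (h.congr fun k => (hsucc k).symm)).norm.bddAbove_range
  exact ⟨M, fun k => hM ⟨k, rfl⟩⟩

/-- The weight `c n ² / binom(2n, n)` decays like `4⁻ⁿ` when `c` is bounded, so it beats every
power of `n`. -/
lemma summable_pow_mul_sq_div_centralBinom {c : ℕ → ℂ} (hc : ∃ M : ℝ, ∀ n, ‖c n‖ ≤ M) (d : ℕ) :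
    Summable fun n : ℕ => (n : ℂ) ^ d * (c n ^ 2 / n.centralBinom) := by
  obtain ⟨M, hM⟩ := hc
  have hs : ∀ e : ℕ, Summable fun n : ℕ => (n : ℝ) ^ e * (1 / 4 : ℝ) ^ n := fun e =>
    summable_pow_mul_geometric_of_norm_lt_one e (by norm_num)
  refine Summable.of_norm_bounded ((((hs (d + 1)).mul_left 2).add (hs d)).mul_left (M ^ 2))
    fun n => ?_
  have hcb : (0 : ℝ) < n.centralBinom := Nat.cast_pos.mpr n.centralBinom_pos
  have h4 : (4 : ℝ) ^ n ≤ (2 * n + 1) * n.centralBinom := by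
    exact_mod_cast Nat.four_pow_le_two_mul_add_one_mul_central_binom n
  have hinv : 1 / (n.centralBinom : ℝ) ≤ (2 * n + 1) * (1 / 4 : ℝ) ^ n := by
    rw [one_div_pow, mul_one_div, div_le_div_iff₀ hcb (by positivity)]
    linarith
  calc ‖(n : ℂ) ^ d * (c n ^ 2 / n.centralBinom)‖
      = (n : ℝ) ^ d * (‖c n‖ ^ 2 * (1 / n.centralBinom)) := by
        simp [div_eq_mul_inv]
    _ ≤ (n : ℝ) ^ d * (M ^ 2 * ((2 * n + 1) * (1 / 4 : ℝ) ^ n)) := by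
        gcongr
        exact hM n
    _ = M ^ 2 * (2 * ((n : ℝ) ^ (d + 1) * (1 / 4 : ℝ) ^ n) + (n : ℝ) ^ d * (1 / 4 : ℝ) ^ n) := by
        ring

/-- Adding the increments of a summable sequence that starts at `0` does not change a sum. -/
lemma HasSum.add_increments {f u : ℕ → ℂ} {a : ℂ} (hf : HasSum f a) (hu : Summable u)
    (h0 : u 0 = 0) : HasSum (fun n => f n + (u (n + 1) - u n)) a := by
  have h := hu.hasSum
  have h' : HasSum (fun n => u (n + 1)) (∑' n, u n) := by
    simpa [h0] using (hasSum_nat_add_iff' 1).mpr h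
  simpa using hf.add (h'.sub h)

/-! ### The Wilf–Zeilberger pair -/

lemma centralBinom_succ_eq (n : ℕ) :
    ((n + 1).centralBinom : ℂ) = 2 * (2 * n + 1) * n.centralBinom / (n + 1) := by
  rw [eq_div_iff (Nat.cast_add_one_ne_zero n), mul_comm]
  exact_mod_cast Nat.succ_mul_centralBinom_succ n

/-- The common factor `((s)_n (1-s)_n)² / ((2n)! n!²)` of the series. -/
noncomputable def weight (s : ℂ) (n : ℕ) : ℂ := pochRatio s (1 - s) n ^ 2 / n.centralBinom

lemma weight_succ (s : ℂ) (n : ℕ) :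
    weight s (n + 1) = weight s n * ((n : ℂ) ^ 2 + n + s * (1 - s)) ^ 2
      / (2 * (2 * n + 1) * ((n : ℂ) + 1) ^ 3) := by
  have h1 : (n : ℂ) + 1 ≠ 0 := Nat.cast_add_one_ne_zero n
  have h2 : (2 * n + 1 : ℂ) ≠ 0 := by exact_mod_cast (2 * n).succ_ne_zero
  have h3 : (n.centralBinom : ℂ) ≠ 0 := Nat.cast_ne_zero.mpr n.centralBinom_ne_zero
  rw [weight, weight, pochRatio_succ, centralBinom_succ_eq]
  field_simp
  ring

lemma summable_pow_mul_weight (s : ℂ) (d : ℕ) : Summable fun n : ℕ => (n : ℂ) ^ d * weight s n :=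
  summable_pow_mul_sq_div_centralBinom (exists_norm_pochRatio_le s) d

/-- The summand whose value at `k = 0` is the `n`-th term of the series with `(3/2)_n`. -/
noncomputable def wzG (s : ℂ) (n k : ℕ) : ℂ :=
  pochRatio s (1 - s) k * weight s n * (s * (1 - s) + 2 * n + 3 * (n : ℂ) ^ 2 + k * (2 * n + 1))
    / ((2 * n + 1) * ((n + k).choose k : ℂ) ^ 2)

/-- The partner of `wzG` in a Wilf–Zeilberger pair. It vanishes for `n = 0`. -/
noncomputable def wzF (s : ℂ) (n k : ℕ) : ℂ :=
  pochRatio s (1 - s) k * weight s n * (2 * n) / ((n + k).choose k : ℂ) ^ 2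

lemma wzG_zero_right (s : ℂ) (n : ℕ) :
    wzG s n 0 = weight s n * ((s * (1 - s) + 2 * n + 3 * (n : ℂ) ^ 2) / (2 * n + 1)) := by
  simp [wzG, pochRatio_zero, mul_div_assoc]

lemma wzG_succ (s : ℂ) (n k : ℕ) :
    wzG s n (k + 1) = wzG s n k + (wzF s (n + 1) k - wzF s n k) := by
  have h1 : (n : ℂ) + 1 ≠ 0 := Nat.cast_add_one_ne_zero n
  have hk : (k : ℂ) + 1 ≠ 0 := Nat.cast_add_one_ne_zero k
  have h2 : (2 * n + 1 : ℂ) ≠ 0 := by exact_mod_cast (2 * n).succ_ne_zero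
  have hnk : (n + k + 1 : ℂ) ≠ 0 := by exact_mod_cast (n + k).succ_ne_zero
  have hC : ((n + k).choose k : ℂ) ≠ 0 :=
    Nat.cast_ne_zero.mpr (Nat.choose_pos (Nat.le_add_left k n)).ne'
  have e1 : ((n + (k + 1)).choose (k + 1) : ℂ) = (n + k + 1) * (n + k).choose k / (k + 1) := by
    rw [eq_div_iff hk]
    exact_mod_cast (Nat.add_one_mul_choose_eq (n + k) k).symm
  have e2 : ((n + 1 + k).choose k : ℂ) = (n + k + 1) * (n + k).choose k / (n + 1) := by
    have h := Nat.choose_mul_succ_eq (n + k) k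
    rw [show n + k + 1 - k = n + 1 by omega, show n + k + 1 = n + 1 + k by omega] at h
    rw [eq_div_iff h1, show (n + k + 1 : ℂ) = n + 1 + k by ring, mul_comm (n + 1 + k : ℂ)]
    exact_mod_cast h.symm
  simp only [wzG, wzF]
  rw [e1, e2, pochRatio_succ, weight_succ]
  push_cast
  field_simp
  ring

lemma one_le_norm_two_mul_add_one (n : ℕ) : 1 ≤ ‖(2 * n + 1 : ℂ)‖ := by
  have h : ‖(2 * n + 1 : ℂ)‖ = 2 * n + 1 := by
    rw [show (2 * n + 1 : ℂ) = ((2 * n + 1 : ℕ) : ℂ) by push_cast; ring, Complex.norm_natCast]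
    push_cast
    ring
  rw [h]
  linarith [(n.cast_nonneg : (0 : ℝ) ≤ n)]

/-- The factor `k` in the numerator of `wzG` is absorbed by `(s)_k (1-s)_k / k!² = O(1 / (k + 1))`,
so `wzG` is dominated in `n` uniformly in `k`. -/
lemma exists_norm_wzG_le (s : ℂ) : ∃ b : ℕ → ℝ, Summable b ∧ (∀ n, 0 ≤ b n) ∧
    ∀ n k : ℕ, ‖wzG s n k‖ ≤ b n / ((n + k).choose k : ℝ) ^ 2 := by
  obtain ⟨M, hM⟩ := exists_norm_pochRatio_mul_le s
  have hM0 : 0 ≤ M := le_trans (by positivity) (hM 0)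
  set w := ‖s * (1 - s)‖ with hw
  have hb : Summable fun n : ℕ => M * (‖weight s n‖ * (w + 4 * n + 3 * (n : ℝ) ^ 2 + 1)) := by
    have hs : ∀ d : ℕ, Summable fun n : ℕ => (n : ℝ) ^ d * ‖weight s n‖ := fun d => by
      simpa using (summable_pow_mul_weight s d).norm
    refine (((((hs 0).mul_left (w + 1)).add ((hs 1).mul_left 4)).add
      ((hs 2).mul_left 3)).mul_left M).congr fun n => ?_
    ring
  refine ⟨_, hb, fun n => by positivity, fun n k => ?_⟩
  have hn0 : (0 : ℝ) ≤ n := n.cast_nonneg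
  have hk0 : (0 : ℝ) ≤ k := k.cast_nonneg
  have hw0 : 0 ≤ w := norm_nonneg _
  have hC : (0 : ℝ) < ((n + k).choose k : ℝ) :=
    Nat.cast_pos.mpr (Nat.choose_pos (Nat.le_add_left k n))
  have hpoly : ‖s * (1 - s) + 2 * n + 3 * (n : ℂ) ^ 2 + k * (2 * n + 1)‖
      ≤ (k + 1) * (w + 4 * n + 3 * (n : ℝ) ^ 2 + 1) := by
    have e : s * (1 - s) + 2 * n + 3 * (n : ℂ) ^ 2 + k * (2 * n + 1)
        = s * (1 - s) + ((2 * n + 3 * n ^ 2 + k * (2 * n + 1) : ℕ) : ℂ) := by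
      push_cast
      ring
    rw [e]
    refine (norm_add_le _ _).trans ?_
    rw [Complex.norm_natCast, ← hw]
    push_cast
    nlinarith [mul_nonneg hk0 hw0, mul_nonneg hk0 hn0, mul_nonneg hk0 (sq_nonneg (n : ℝ))]
  rw [wzG, norm_div, norm_mul, norm_mul, norm_mul, norm_pow, Complex.norm_natCast]
  gcongr ?_ / ?_
  · calc ‖pochRatio s (1 - s) k‖ * ‖weight s n‖
          * ‖s * (1 - s) + 2 * n + 3 * (n : ℂ) ^ 2 + k * (2 * n + 1)‖
        ≤ ‖pochRatio s (1 - s) k‖ * ‖weight s n‖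
          * ((k + 1) * (w + 4 * n + 3 * (n : ℝ) ^ 2 + 1)) := by gcongr
      _ = (‖pochRatio s (1 - s) k‖ * (k + 1))
          * (‖weight s n‖ * (w + 4 * n + 3 * (n : ℝ) ^ 2 + 1)) := by ring
      _ ≤ M * (‖weight s n‖ * (w + 4 * n + 3 * (n : ℝ) ^ 2 + 1)) := by
        gcongr
        exact hM k
  · exact le_mul_of_one_le_left (by positivity) (one_le_norm_two_mul_add_one n)

lemma norm_wzG_le_of_bound {s : ℂ} {b : ℕ → ℝ} (hb0 : ∀ n, 0 ≤ b n)
    (hb : ∀ n k : ℕ, ‖wzG s n k‖ ≤ b n / ((n + k).choose k : ℝ) ^ 2) (n k : ℕ) :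
    ‖wzG s n k‖ ≤ b n := by
  refine (hb n k).trans (div_le_self (hb0 n) (one_le_pow₀ ?_))
  exact_mod_cast Nat.choose_pos (Nat.le_add_left k n)

lemma summable_wzF (s : ℂ) (k : ℕ) : Summable fun n => wzF s n k := by
  refine Summable.of_norm_bounded
    (((summable_pow_mul_weight s 1).norm).mul_left (2 * ‖pochRatio s (1 - s) k‖)) fun n => ?_
  have hC : (1 : ℝ) ≤ ((n + k).choose k : ℝ) ^ 2 :=
    one_le_pow₀ (by exact_mod_cast Nat.choose_pos (Nat.le_add_left k n))
  rw [wzF, norm_div, norm_pow, Complex.norm_natCast]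
  refine (div_le_self (norm_nonneg _) hC).trans (le_of_eq ?_)
  simp only [norm_mul, pow_one, Complex.norm_natCast, Complex.norm_ofNat]
  ring

/-- The sum of `wzG s n k` over `n` does not depend on `k`; as `k → ∞` only the term `n = 0`
survives, and it tends to `sin (π s) / π`. -/
lemma hasSum_wzG_zero (s : ℂ) :
    HasSum (fun n => wzG s n 0) (Complex.sin (Real.pi * s) / Real.pi) := by
  obtain ⟨b, hbs, hb0, hb⟩ := exists_norm_wzG_le s
  have hle := norm_wzG_le_of_bound hb0 hb
  have h0 : HasSum (fun n => wzG s n 0) (∑' n, wzG s n 0) :=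
    (Summable.of_norm_bounded hbs fun n => hle n 0).hasSum
  have hk : ∀ k, HasSum (fun n => wzG s n k) (∑' n, wzG s n 0) := by
    intro k
    induction k with
    | zero => exact h0
    | succ k ih =>
      simpa only [wzG_succ] using ih.add_increments (summable_wzF s k) (by simp [wzF])
  set L := Complex.sin (Real.pi * s) / Real.pi with hL
  have hlim : Tendsto (fun k => ∑' n, wzG s n k) atTop
      (𝓝 (∑' n : ℕ, if n = 0 then L else 0)) := by
    refine tendsto_tsum_of_dominated_convergence hbs (fun n => ?_)
      (Eventually.of_forall fun k n => hle n k)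
    rcases Nat.eq_zero_or_pos n with rfl | hn
    · refine (tendsto_pochRatio_mul_add s (s * (1 - s))).congr fun k => ?_
      simp [wzG, weight, pochRatio_zero, add_comm]
    · rw [if_neg hn.ne']
      -- For `n ≥ 1` the binomial coefficient in the denominator is at least `k + 1`.
      refine squeeze_zero_norm (a := fun k : ℕ => b n * (1 / ((k : ℝ) + 1))) (fun k => ?_) ?_
      · refine (hb n k).trans ?_
        have hC : (k : ℝ) + 1 ≤ ((n + k).choose k : ℝ) := by
          have h := Nat.choose_le_choose k (show k + 1 ≤ n + k by omega)
          rw [Nat.choose_succ_self_right] at h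
          exact_mod_cast h
        rw [div_eq_mul_one_div]
        have := hb0 n
        have hk1 : (1 : ℝ) ≤ (k : ℝ) + 1 := le_add_of_nonneg_left k.cast_nonneg
        gcongr
        nlinarith
      · simpa using (tendsto_one_div_add_atTop_nhds_zero_nat (𝕜 := ℝ)).const_mul (b n)
  rw [tsum_ite_eq] at hlim
  rw [← tendsto_nhds_unique (tendsto_const_nhds.congr fun k => ((hk k).tsum_eq).symm) hlim]
  exact h0

/-! ### The series -/

/-- The terms of the series with `(1/2)_n`, rewritten by `(1/2)_n n! 4ⁿ = (2n)!`. -/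
lemma series_term_eq (a b z d : ℂ) (n : ℕ) :
    (ascPochhammer ℂ n).eval a ^ 2 * (ascPochhammer ℂ n).eval b ^ 2
        / ((ascPochhammer ℂ n).eval (1 / 2 : ℂ) * (n.factorial : ℂ) ^ 3) * (z / (d * 4 ^ n))
      = pochRatio a b n ^ 2 / n.centralBinom * (z / d) := by
  have h2 : (n.factorial : ℂ) ≠ 0 := Nat.cast_ne_zero.mpr n.factorial_ne_zero
  have h3 : (n.centralBinom : ℂ) ≠ 0 := Nat.cast_ne_zero.mpr n.centralBinom_ne_zero
  have h4 : (4 : ℂ) ^ n ≠ 0 := pow_ne_zero _ (by norm_num)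
  rw [eq_div_of_mul_eq h4 (ascPochhammer_half_eval n), pochRatio, div_mul_eq_div_div z]
  field_simp

lemma hasSum_three_halves (s : ℂ) :
    HasSum (fun n : ℕ =>
      ((ascPochhammer ℂ n).eval s ^ 2 * (ascPochhammer ℂ n).eval (1 - s) ^ 2
          / ((ascPochhammer ℂ n).eval (3 / 2 : ℂ) * (n.factorial : ℂ) ^ 3))
        * ((s * (1 - s) + 2 * (n : ℂ) + 3 * (n : ℂ) ^ 2) / 4 ^ n))
      (Complex.sin (Real.pi * s) / Real.pi) := by
  convert! hasSum_wzG_zero s using 2 with n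
  have h := series_term_eq s (1 - s) (s * (1 - s) + 2 * (n : ℂ) + 3 * (n : ℂ) ^ 2) (2 * n + 1) n
  rw [← weight] at h
  rw [wzG_zero_right, ← h, ascPochhammer_three_halves_eval]
  simp only [div_eq_mul_inv, mul_inv]
  ring

/-- The summand differs from `wzG s n 0` by the increments of
`8 n³ weight s n / (1 - 2s)²`. -/
lemma hasSum_half_one_sub {s : ℂ} (hs : s ≠ 1 / 2) :
    HasSum (fun n : ℕ =>
      ((ascPochhammer ℂ n).eval s ^ 2 * (ascPochhammer ℂ n).eval (1 - s) ^ 2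
          / ((ascPochhammer ℂ n).eval (1 / 2 : ℂ) * (n.factorial : ℂ) ^ 3))
        * ((s * (1 - s) + 2 * (1 - s + s ^ 2) * (n : ℂ) + 3 * (n : ℂ) ^ 2 - 6 * (n : ℂ) ^ 3)
          / ((1 - 2 * s) ^ 2 * 4 ^ n)))
      (Complex.sin (Real.pi * s) / Real.pi) := by
  have hs' : 1 - 2 * s ≠ 0 := fun h => hs (by linear_combination -h / 2)
  have hu := (summable_pow_mul_weight s 3).mul_left (8 / (1 - 2 * s) ^ 2)
  have h := (hasSum_wzG_zero s).add_increments hu (by simp)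
  convert! h using 2 with n
  have h1 : (n : ℂ) + 1 ≠ 0 := Nat.cast_add_one_ne_zero n
  have h2 : (2 * n + 1 : ℂ) ≠ 0 := by exact_mod_cast (2 * n).succ_ne_zero
  rw [series_term_eq, ← weight, weight_succ, wzG_zero_right]
  push_cast
  have hs'' : 1 - s * 2 ≠ 0 := by rwa [mul_comm]
  field_simp
  ring

/-- The summand differs from `wzG s n 0` by the increments of
`2 n³ ((s)_n (-s)_n)² / (s² (2n)! n!²)`. -/
lemma hasSum_half_neg {s : ℂ} (hs : s ≠ 0) :
    HasSum (fun n : ℕ =>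
      ((ascPochhammer ℂ n).eval s ^ 2 * (ascPochhammer ℂ n).eval (-s) ^ 2
          / ((ascPochhammer ℂ n).eval (1 / 2 : ℂ) * (n.factorial : ℂ) ^ 3))
        * ((s ^ 2 - 3 * (n : ℂ) ^ 2) / (s * 4 ^ n)))
      (Complex.sin (Real.pi * s) / Real.pi) := by
  have hu := (summable_pow_mul_sq_div_centralBinom (exists_norm_pochRatio_neg_le s) 3).mul_left
    (2 / s ^ 2)
  have h := (hasSum_wzG_zero s).add_increments hu (by simp)
  convert! h using 2 with n
  have h1 : (n : ℂ) + 1 ≠ 0 := Nat.cast_add_one_ne_zero n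
  have h2 : (2 * n + 1 : ℂ) ≠ 0 := by exact_mod_cast (2 * n).succ_ne_zero
  have h3 : (n.centralBinom : ℂ) ≠ 0 := Nat.cast_ne_zero.mpr n.centralBinom_ne_zero
  have hP : pochRatio s (1 - s) n = pochRatio s (-s) n * (s - n) / s := by
    rw [eq_div_iff hs]
    simp only [pochRatio]
    linear_combination ((ascPochhammer ℂ n).eval s / (n.factorial : ℂ) ^ 2)
      * ascPochhammer_neg_mul s n
  rw [series_term_eq, pochRatio_succ, centralBinom_succ_eq, wzG_zero_right, weight, hP]
  push_cast
  have h2' : (n * 2 + 1 : ℂ) ≠ 0 := by rwa [mul_comm]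
  field_simp
  ring

lemma pochRatio_quarter (n : ℕ) :
    pochRatio (1 / 4) (1 - 1 / 4) n = (2 * n).centralBinom * n.centralBinom / 64 ^ n := by
  induction n with
  | zero => simp [pochRatio_zero]
  | succ n ih =>
    have h1 : (n : ℂ) + 1 ≠ 0 := Nat.cast_add_one_ne_zero n
    have h2 : (2 * n + 1 : ℂ) ≠ 0 := by exact_mod_cast (2 * n).succ_ne_zero
    rw [pochRatio_succ, ih, show 2 * (n + 1) = 2 * n + 1 + 1 by ring, centralBinom_succ_eq,
      centralBinom_succ_eq, centralBinom_succ_eq]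
    push_cast
    have h2' : (n * 2 + 1 : ℂ) ≠ 0 := by rwa [mul_comm]
    rw [show (2 * n + 1 + 1 : ℂ) = 2 * (n + 1) by ring]
    field_simp
    ring

theorem mainTheorem5 :
    (∀ s : ℂ,
      (s ≠ 1 / 2 →
        HasSum (fun n : ℕ =>
          ((ascPochhammer ℂ n).eval s ^ 2 * (ascPochhammer ℂ n).eval (1 - s) ^ 2
              / ((ascPochhammer ℂ n).eval (1 / 2 : ℂ) * (n.factorial : ℂ) ^ 3))
            * ((s * (1 - s) + 2 * (1 - s + s ^ 2) * (n : ℂ) + 3 * (n : ℂ) ^ 2 - 6 * (n : ℂ) ^ 3)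
              / ((1 - 2 * s) ^ 2 * 4 ^ n)))
          (Complex.sin (Real.pi * s) / Real.pi)) ∧
      HasSum (fun n : ℕ =>
        ((ascPochhammer ℂ n).eval s ^ 2 * (ascPochhammer ℂ n).eval (1 - s) ^ 2
            / ((ascPochhammer ℂ n).eval (3 / 2 : ℂ) * (n.factorial : ℂ) ^ 3))
          * ((s * (1 - s) + 2 * (n : ℂ) + 3 * (n : ℂ) ^ 2) / 4 ^ n))
        (Complex.sin (Real.pi * s) / Real.pi) ∧
      (s ≠ 0 →
        HasSum (fun n : ℕ =>
          ((ascPochhammer ℂ n).eval s ^ 2 * (ascPochhammer ℂ n).eval (-s) ^ 2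
              / ((ascPochhammer ℂ n).eval (1 / 2 : ℂ) * (n.factorial : ℂ) ^ 3))
            * ((s ^ 2 - 3 * (n : ℂ) ^ 2) / (s * 4 ^ n)))
          (Complex.sin (Real.pi * s) / Real.pi))) ∧
    HasSum (fun n : ℕ =>
      ((4 * n).choose (2 * n) : ℝ) ^ 2 * ((2 * n).choose n : ℝ)
        * ((3 + 26 * (n : ℝ) + 48 * (n : ℝ) ^ 2 - 96 * (n : ℝ) ^ 3) / 2 ^ (12 * n)))
      (2 * Real.sqrt 2 / Real.pi) := by
  refine ⟨fun s => ⟨hasSum_half_one_sub, hasSum_three_halves s, hasSum_half_neg⟩, ?_⟩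
  have h := (hasSum_half_one_sub (s := 1 / 4) (by norm_num)).mul_left 4
  have hsin : Complex.sin (Real.pi * (1 / 4)) = ((Real.sqrt 2 / 2 : ℝ) : ℂ) := by
    rw [← Real.sin_pi_div_four, Complex.ofReal_sin]
    push_cast
    ring_nf
  rw [← Complex.hasSum_ofReal]
  convert! h using 2 with n
  · have h3 : (n.centralBinom : ℂ) ≠ 0 := Nat.cast_ne_zero.mpr n.centralBinom_ne_zero
    have hpow : (2 : ℂ) ^ (12 * n) = 64 ^ n * 64 ^ n := by
      rw [← mul_pow, pow_mul]
      norm_num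
    have h4 : (64 : ℂ) ^ n ≠ 0 := pow_ne_zero _ (by norm_num)
    rw [series_term_eq, pochRatio_quarter, show 4 * n = 2 * (2 * n) by ring,
      ← Nat.centralBinom_eq_two_mul_choose, ← Nat.centralBinom_eq_two_mul_choose]
    push_cast
    rw [hpow]
    field_simp
    ring
  · rw [hsin]
    push_cast
    ring
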